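/- Let $q$ be a prime power and $0<u<q^{1/2}$. For a partition $\lambda$ let $|\lambda|$ be its size, $l(\lambda)$ its number of parts, $o(\lambda)$ its number of odd parts (counted with multiplicity), $m_i(\lambda)$ the number of parts equal to $i$, $\lambda_i'=m_i(\lambda)+m_{i+1}(\lambda)+\cdots$ its $i$-th column length, and $n(\lambda)=\sum_{i\ge 1}\binom{\lambda_i'}{2}$. Let $R_{(u,q)}$ be the measure on the set of all partitions $\lambda$ (of all sizes, including the empty partition) in which every odd part occurs with even multiplicity, given by \[ R_{(u,q)}(\lambda)=\frac{\prod_{i\ge1}(1-u^2/q^{2i-1})}{1+u^2}\cdot\frac{q^{l(\lambda)}u^{|\lambda|}}{q^{n(\lambda)+\frac{|\lambda|}{2}+\frac{o(\lambda)}{2}}\prod_{i\ge1}\prod_{j=1}^{\lfloor m_i(\lambda)/2\rfloor}(1-1/q^{2j})}. \] For $a\ge 0$ put $D(a)=\prod_{1\le j\le a,\ j\text{ odd}}(1-u^2/q^{j})\prod_{1\le j\le a,\ j\text{ even}}(1-1/q^{j})$, and for $k\geq 0$ \[ P'_{Sp,u}(2k)=\frac{u^{2k}}{q^{2k^2+k}D(2k)},\qquad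 P'_{Sp,u}(2k+1)=\frac{u^{2k+2}}{q^{2k^2+3k+1}D(2k+1)}, \] \[ P'_{O,u}(2k)=\frac{u^{2k}}{q^{2k^2-k}D(2k)},\qquad P'_{O,u}(2k+1)=\frac{u^{2k+1}}{q^{2k^2+k}D(2k+1)}. \] With $F(m)=\prod_{j=1}^{m}(q^{2j}-1)$, define for natural numbers $a,b$ \[ K_1(a,b)=\frac{u^aP'_{O,u}(b)}{P'_{Sp,u}(a)\,q^{\frac{a^2-b^2+2(a+1)b}{4}}\,F(\frac{a-b}{2})}\quad\text{if } b\le a,\ a-b\text{ even},\qquad K_1(a,b)=0\ \text{ otherwise}, \] \[ K_2(a,b)=\begin{cases}\dfrac{u^aP'_{Sp,u}(b)\,q^{(a-b)^2/4}}{P'_{O,u}(a)\,q^{\frac{a^2+b}{2}-a}\,F(\frac{a-b}{2})} & b\le a,\ a-b\text{ even},\\[2ex] \dfrac{u^aP'_{Sp,u}(b)\,q^{((a-b)^2-1)/4}}{P'_{O,u}(a)\,q^{\frac{a^2-a}{2}}\,F(\frac{a-b-1}{2})} & b\le a,\ a-b\text{ odd},\\[2ex] 0 & b>a.\end{cases}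 \] Let $\lambda_1'$ be a random natural number which, for each $k\ge0$, equals $2k$ with probability $\frac{\prod_{i\ge1}(1-u^2/q^{2i-1})}{1+u^2}\cdot\frac{u^{2k}}{q^{2k^2-k}D(2k)}$ and equals $2k+1$ with probability $\frac{\prod_{i\ge1}(1-u^2/q^{2i-1})}{1+u^2}\cdot\frac{u^{2k+2}}{q^{2k^2+k}D(2k+1)}$. Define $\lambda_2',\lambda_3',\dots$ successively by the rule that if $\lambda_i'=a$, then, conditionally on $\lambda_1',\dots,\lambda_i'$, $\lambda_{i+1}'=b$ with probability $K_1(a,b)$ if $i$ is odd and with probability $K_2(a,b)$ if $i$ is even. Then these prescriptions are consistent (the stated initial probabilities are nonnegative and sum to $1$, and for every $a$ the numbers $K_1(a,b)$, $b\ge0$, and the numbers $K_2(a,b)$, $b\ge 0$, are nonnegative and sum to $1$, so that such a random sequence exists), almost surely $(\lambda_i')_{i\ge1}$ is the sequence of column lengths of a partition in which every odd part occurs with even multiplicity, and this random partition is distributed according to $R_{(u,q)}$. -/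

import Mathlib

open MeasureTheory ProbabilityTheory

namespace RandomPartition

noncomputable section

/-! ### Partitions and the measure `R_(u,q)` -/

/-- Partitions of all natural numbers in which every odd part has even multiplicity. -/
def Ptn : Type :=
  {p : Σ n : ℕ, n.Partition // ∀ i : ℕ, Odd i → Even (p.2.parts.count i)}

/-- The set of partitions carries the discrete `σ`-algebra. -/
instance : MeasurableSpace Ptn := ⊤

namespace Ptn

/-- The multiset of the (positive) parts. -/
def parts (l : Ptn) : Multiset ℕ := l.1.2.parts

/-- The size `|λ|`, i.e. the sum of the parts. -/
def size (l : Ptn) : ℕ := l.1.1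

/-- The number of parts `l(λ)`. -/
def length (l : Ptn) : ℕ := l.parts.card

/-- The multiplicity `m_i(λ)` of the part `i`. -/
def mult (l : Ptn) (i : ℕ) : ℕ := l.parts.count i

/-- The number `o(λ)` of odd parts, counted with multiplicity. -/
def numOdd (l : Ptn) : ℕ := (l.parts.filter (fun x => Odd x)).card

/-- The `i`-th column length (`i ≥ 1`): `λ'_i = m_i(λ) + m_{i+1}(λ) + ⋯`,
the number of parts that are at least `i`. -/
def col (l : Ptn) (i : ℕ) : ℕ := (l.parts.filter (fun x => i ≤ x)).card

/-- `n(λ) = ∑_{i ≥ 1} (λ'_i choose 2)`; the terms with `i > |λ|` vanish. -/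
def nStat (l : Ptn) : ℕ := ∑ i ∈ Finset.Icc 1 l.size, (l.col i).choose 2

end Ptn

/-- The constant `∏_{i ≥ 1} (1 - u² / q^(2i-1)) / (1 + u²)`; the product is indexed from `0`. -/
def normConst (q : ℕ) (u : ℝ) : ℝ :=
  (∏' i : ℕ, (1 - u ^ 2 / (q : ℝ) ^ (2 * i + 1))) / (1 + u ^ 2)

/-- The mass that `R_(u,q)` gives to the partition `l`; the exponent of `q` in the denominator is
the real number `n(λ) + |λ|/2 + o(λ)/2`, and the factors with `m_i(λ) = 0` are `1`. -/
def weight (q : ℕ) (u : ℝ) (l : Ptn) : ℝ :=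
  normConst q u *
    ((q : ℝ) ^ l.length * u ^ l.size /
      ((q : ℝ) ^ ((l.nStat : ℝ) + (l.size : ℝ) / 2 + (l.numOdd : ℝ) / 2) *
        ∏ i ∈ Finset.Icc 1 l.size, ∏ j ∈ Finset.Icc 1 (l.mult i / 2),
          (1 - 1 / (q : ℝ) ^ (2 * j))))

/-- The measure `R_(u,q)` on the partitions all of whose odd parts have even multiplicity. -/
def R (q : ℕ) (u : ℝ) : Measure Ptn :=
  Measure.sum fun l : Ptn => ENNReal.ofReal (weight q u l) • Measure.dirac l

/-! ### The law of the first column and the two kernels -/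

/-- `(1 - u²/q) (1 - 1/q²) (1 - u²/q³) (1 - 1/q⁴) ⋯`, the product of the first `a` factors. -/
def altProd (q : ℕ) (u : ℝ) (a : ℕ) : ℝ :=
  ∏ j ∈ Finset.Icc 1 a,
    if Odd j then 1 - u ^ 2 / (q : ℝ) ^ j else 1 - 1 / (q : ℝ) ^ j

/-- `P'_{Sp,u}(a)`, where `a = 2k` or `a = 2k+1`. -/
def PSp (q : ℕ) (u : ℝ) (a : ℕ) : ℝ :=
  let k := a / 2
  if Even a then u ^ (2 * k) / ((q : ℝ) ^ (2 * k ^ 2 + k) * altProd q u a)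
  else u ^ (2 * k + 2) / ((q : ℝ) ^ (2 * k ^ 2 + 3 * k + 1) * altProd q u a)

/-- `P'_{O,u}(a)`, where `a = 2k` or `a = 2k+1`; note `k ≤ 2k²`. -/
def PO (q : ℕ) (u : ℝ) (a : ℕ) : ℝ :=
  let k := a / 2
  if Even a then u ^ (2 * k) / ((q : ℝ) ^ (2 * k ^ 2 - k) * altProd q u a)
  else u ^ (2 * k + 1) / ((q : ℝ) ^ (2 * k ^ 2 + k) * altProd q u a)

/-- `(q^(2m) - 1) ⋯ (q⁴ - 1) (q² - 1)`. -/
def evenProd (q m : ℕ) : ℝ := ∏ j ∈ Finset.Icc 1 m, ((q : ℝ) ^ (2 * j) - 1)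

/-- The transition probabilities `K₁(a,b)`; the exponent of `q` is a real number. -/
def K1 (q : ℕ) (u : ℝ) (a b : ℕ) : ℝ :=
  if b ≤ a ∧ Even (a - b) then
    u ^ a * PO q u b /
      (PSp q u a * (q : ℝ) ^ (((a : ℝ) ^ 2 - (b : ℝ) ^ 2 + 2 * ((a : ℝ) + 1) * (b : ℝ)) / 4) *
        evenProd q ((a - b) / 2))
  else 0

/-- The transition probabilities `K₂(a,b)`; the exponents of `q` are real numbers. -/
def K2 (q : ℕ) (u : ℝ) (a b : ℕ) : ℝ :=
  if b ≤ a then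
    if Even (a - b) then
      u ^ a * PSp q u b * (q : ℝ) ^ (((a : ℝ) - (b : ℝ)) ^ 2 / 4) /
        (PO q u a * (q : ℝ) ^ (((a : ℝ) ^ 2 + (b : ℝ)) / 2 - (a : ℝ)) *
          evenProd q ((a - b) / 2))
    else
      u ^ a * PSp q u b * (q : ℝ) ^ ((((a : ℝ) - (b : ℝ)) ^ 2 - 1) / 4) /
        (PO q u a * (q : ℝ) ^ (((a : ℝ) ^ 2 - (a : ℝ)) / 2) *
          evenProd q ((a - b - 1) / 2))
  else 0

/-- The probability that the first column length equals `a`, where `a = 2k` or `a = 2k+1`. -/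
def initProb (q : ℕ) (u : ℝ) (a : ℕ) : ℝ :=
  let k := a / 2
  if Even a then
    normConst q u * (u ^ (2 * k) / ((q : ℝ) ^ (2 * k ^ 2 - k) * altProd q u a))
  else
    normConst q u * (u ^ (2 * k + 2) / ((q : ℝ) ^ (2 * k ^ 2 + k) * altProd q u a))

/-- The kernel for the step from `λ'_i` to `λ'_{i+1}`: `K₁` if `i` is odd, `K₂` if `i` is even. -/
def stepProb (q : ℕ) (u : ℝ) (i : ℕ) (a b : ℕ) : ℝ :=
  if Odd i then K1 q u a b else K2 q u a b

/-- A process `X 0 = λ'_1, X 1 = λ'_2, …` of random natural numbers, i.e. `X i = λ'_{i+1}`, is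
generated by the sampling procedure: `X 0` has law `initProb`, and given the values
`X 0 = a 0, …, X n = a n`, the value of `X (n+1)` is `b` with probability
`stepProb (n+1) (a n) b`. -/
structure IsColumnChain (q : ℕ) (u : ℝ) {Ω : Type*} [MeasurableSpace Ω] (μ : Measure Ω)
    (X : ℕ → Ω → ℕ) : Prop where
  measurable : ∀ i, Measurable (X i)
  init : ∀ a : ℕ, μ {ω | X 0 ω = a} = ENNReal.ofReal (initProb q u a)
  step : ∀ (n : ℕ) (a : ℕ → ℕ) (b : ℕ),
    μ {ω | (∀ i ≤ n, X i ω = a i) ∧ X (n + 1) ω = b} =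
      μ {ω | ∀ i ≤ n, X i ω = a i} * ENNReal.ofReal (stepProb q u (n + 1) (a n) b)

end

end RandomPartition

/-!
The transition probabilities become transparent after rewriting. With `D = altProd`,
`w(b) = u^b / q^(b choose 2)` (`colMass`) and `E(m) = ∏_{j ≤ m} (1 - 1/q^(2j))` (`evenPoch`), one has

* `initProb a = normConst * w(a) u^(a mod 2) / D(a)` (`initProb_eq`),
* `K₁(a,b) = w(b) D(a) / (D(b) E((a-b)/2) u^(b mod 2))` (`K1_eq`),
* `K₂(a,b) = w(b) u^(b mod 2) D(a) / (q^b D(b) E(⌊(a-b)/2⌋))` (`K2_eq`).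

*Normalisation.* Put `Q = 1/q²` and `y = u²/q`; then `D` is a product of two `Q`-Pochhammer symbols,
of base points `y` and `Q`. A row of `K₁` (nonzero entries), or of `K₂` (entries paired as
`2k, 2k+1`), consists of the summands of the `q`-Vandermonde identity
`∑_k [n choose k]_Q (yQ^k; Q)_(n-k) y^k Q^(k(k-1)) = 1`, at `y` or at `yQ`
(`sum_range_vandermondeTerm`, proved by induction on `n` from Pascal's rule). The initial law splits
into its even and odd part, each of which is summed by Cauchy's identity, the limit `n → ∞` of the
`q`-Vandermonde identity (`tprod_mul_tsum_cauchyTerm`).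

*Law.* In the product of the transition probabilities along a sequence of columns the factors `D` and
the parity powers of `u` telescope (`prefixProb_eq`). What is left is
`normConst * u^|λ| / (q^(n(λ)) q^(λ'_3 + λ'_5 + ⋯) ∏_i E(⌊m_i/2⌋))`, and this is the mass of `λ` under
`R_(u,q)`, since the columns in odd positions have total length `(|λ| + o(λ))/2`
(`prefixProb_col`).

*Absorption.* Almost surely all steps have positive probability, so the sequence is nonincreasing,
with even drops at odd positions. It is therefore eventually constant, and the constant is `0` because
`K₂(a,a) < 1` for `a ≠ 0` (`IsColumnChain.ae_not_eventually_const`). Hence it is almost surely the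
sequence of column lengths of a partition. The chain itself exists by the Ionescu-Tulcea theorem.
-/

namespace RandomPartition

/-! ### The `q`-Vandermonde and Cauchy identities -/

/-- The `q`-Pochhammer symbol `(y; Q)_n = (1 - y) (1 - yQ) ⋯ (1 - yQ^(n-1))`. -/
noncomputable def qPoch (y Q : ℝ) (n : ℕ) : ℝ := ∏ i ∈ Finset.range n, (1 - y * Q ^ i)

@[simp] lemma qPoch_zero (y Q : ℝ) : qPoch y Q 0 = 1 := by simp [qPoch]

lemma qPoch_succ (y Q : ℝ) (n : ℕ) : qPoch y Q (n + 1) = qPoch y Q n * (1 - y * Q ^ n) :=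
  Finset.prod_range_succ _ _

lemma qPoch_succ_left (y Q : ℝ) (n : ℕ) :
    qPoch y Q (n + 1) = (1 - y) * qPoch (y * Q) Q n := by
  rw [qPoch, Finset.prod_range_succ', qPoch, mul_comm]
  simp [pow_succ', mul_assoc]

lemma qPoch_add (y Q : ℝ) (k m : ℕ) :
    qPoch y Q (k + m) = qPoch y Q k * qPoch (y * Q ^ k) Q m := by
  simp [qPoch, Finset.prod_range_add, pow_add, mul_assoc]

lemma qPoch_pos {y Q : ℝ} (hy : y < 1) (hy0 : 0 ≤ y) (hQ0 : 0 ≤ Q) (hQ : Q < 1) (n : ℕ) :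
    0 < qPoch y Q n := by
  refine Finset.prod_pos fun i _ => ?_
  nlinarith [pow_le_one₀ hQ0 hQ.le (n := i), pow_nonneg hQ0 i]

lemma qPoch_le_one {y Q : ℝ} (hy : y < 1) (hy0 : 0 ≤ y) (hQ0 : 0 ≤ Q) (hQ : Q < 1) (n : ℕ) :
    qPoch y Q n ≤ 1 := by
  refine Finset.prod_le_one (fun i _ => ?_) (fun i _ => ?_)
  · nlinarith [pow_le_one₀ hQ0 hQ.le (n := i), pow_nonneg hQ0 i]
  · nlinarith [pow_nonneg hQ0 i]

/-- The summand `[n choose k]_Q (yQ^k; Q)_(n-k) y^k Q^(k(k-1))` of the `q`-Vandermonde identity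
for `n = k + m`, divided by `(Q; Q)_n`. -/
noncomputable def vandermondeTerm (y Q : ℝ) (k m : ℕ) : ℝ :=
  qPoch (y * Q ^ k) Q m * y ^ k * Q ^ (k * (k - 1)) / (qPoch Q Q k * qPoch Q Q m)

/-- Pascal's rule for the summands: the two ways to enlarge `(k, m)` by one combine to the summand
with `y` replaced by `yQ`. -/
lemma vandermondeTerm_pascal {Q : ℝ} (hQ0 : 0 ≤ Q) (hQ : Q < 1) (y : ℝ) (k m : ℕ) :
    Q ^ k * (1 - Q ^ (m + 1)) * vandermondeTerm y Q k (m + 1) +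
      (1 - Q ^ (k + 1)) * vandermondeTerm y Q (k + 1) m = vandermondeTerm (y * Q) Q k m := by
  have h (n : ℕ) : qPoch Q Q n ≠ 0 := (qPoch_pos hQ hQ0 hQ0 hQ n).ne'
  have h1 (n : ℕ) : 1 - Q ^ (n + 1) ≠ 0 :=
    (sub_pos.2 (pow_lt_one₀ hQ0 hQ n.succ_ne_zero)).ne'
  have e (n : ℕ) : qPoch Q Q (n + 1) = qPoch Q Q n * (1 - Q ^ (n + 1)) := by
    rw [qPoch_succ, pow_succ']
  have e2 : Q ^ ((k + 1) * k) = Q ^ k * Q ^ k * Q ^ (k * (k - 1)) := by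
    cases k with
    | zero => simp
    | succ k => simp only [Nat.add_sub_cancel]; ring
  simp only [vandermondeTerm, e, qPoch_succ_left (y * Q ^ k), Nat.add_sub_cancel, e2]
  have e3 : y * Q * Q ^ k = y * Q ^ (k + 1) := by ring
  have e4 : y * Q ^ k * Q = y * Q ^ (k + 1) := by ring
  rw [e3, e4]
  have := h k; have := h m; have := h1 k; have := h1 m
  field_simp
  ring

/-- The `q`-Vandermonde identity. -/
lemma sum_antidiagonal_vandermondeTerm {Q : ℝ} (hQ0 : 0 ≤ Q) (hQ : Q < 1) (n : ℕ) (y : ℝ) :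
    ∑ p ∈ Finset.HasAntidiagonal.antidiagonal n, vandermondeTerm y Q p.1 p.2 = (qPoch Q Q n)⁻¹ := by
  induction n generalizing y with
  | zero => simp [vandermondeTerm]
  | succ n ih =>
    have h1 : 1 - Q ^ (n + 1) ≠ 0 := (sub_pos.2 (pow_lt_one₀ hQ0 hQ n.succ_ne_zero)).ne'
    have key : (1 - Q ^ (n + 1)) *
        ∑ p ∈ Finset.HasAntidiagonal.antidiagonal (n + 1), vandermondeTerm y Q p.1 p.2 = (qPoch Q Q n)⁻¹ := by
      have split : ∀ p ∈ Finset.HasAntidiagonal.antidiagonal (n + 1),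
          (1 - Q ^ (n + 1)) * vandermondeTerm y Q p.1 p.2 =
          Q ^ p.1 * (1 - Q ^ p.2) * vandermondeTerm y Q p.1 p.2 +
            (1 - Q ^ p.1) * vandermondeTerm y Q p.1 p.2 := by
        intro p hp
        rw [← Finset.HasAntidiagonal.mem_antidiagonal.1 hp, pow_add]
        ring
      rw [Finset.mul_sum, Finset.sum_congr rfl split, Finset.sum_add_distrib,
        Finset.Nat.sum_antidiagonal_succ', Finset.Nat.sum_antidiagonal_succ]
      simp only [pow_zero, sub_self, mul_zero, zero_mul, zero_add, ← Finset.sum_add_distrib,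
        vandermondeTerm_pascal hQ0 hQ, ih]
    rw [qPoch_succ, ← pow_succ', mul_inv, ← key]
    field_simp

/-- The `q`-Vandermonde identity, normalised to have value `1`. -/
lemma sum_range_vandermondeTerm {Q : ℝ} (hQ0 : 0 ≤ Q) (hQ : Q < 1) (n : ℕ) (y : ℝ) :
    ∑ k ∈ Finset.range (n + 1), qPoch Q Q n * vandermondeTerm y Q k (n - k) = 1 := by
  rw [← Finset.mul_sum, ← Finset.Nat.sum_antidiagonal_eq_sum_range_succ (vandermondeTerm y Q),
    sum_antidiagonal_vandermondeTerm hQ0 hQ, mul_inv_cancel₀ (qPoch_pos hQ hQ0 hQ0 hQ n).ne']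

/-- The summand `y^k Q^(k(k-1)) / ((Q; Q)_k (y; Q)_k)` of Cauchy's identity. -/
noncomputable def cauchyTerm (y Q : ℝ) (k : ℕ) : ℝ :=
  y ^ k * Q ^ (k * (k - 1)) / (qPoch Q Q k * qPoch y Q k)

lemma cauchyTerm_nonneg {y Q : ℝ} (hy : y < 1) (hy0 : 0 ≤ y) (hQ0 : 0 ≤ Q) (hQ : Q < 1) (k : ℕ) :
    0 ≤ cauchyTerm y Q k := by
  have := qPoch_pos hy hy0 hQ0 hQ k
  have := qPoch_pos hQ hQ0 hQ0 hQ k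
  unfold cauchyTerm
  positivity

lemma summable_cauchyTerm {y Q : ℝ} (hy : y < 1) (hy0 : 0 < y) (hQ0 : 0 < Q) (hQ : Q < 1) :
    Summable (cauchyTerm y Q) := by
  have p1 (k) := qPoch_pos hy hy0.le hQ0.le hQ k
  have p2 (k) := qPoch_pos hQ hQ0.le hQ0.le hQ k
  have pos (k) : 0 < cauchyTerm y Q k := by
    have := p1 k; have := p2 k
    unfold cauchyTerm; positivity
  refine summable_of_ratio_test_tendsto_lt_one (l := 0) one_pos
    (Filter.Eventually.of_forall fun n => (pos n).ne') ?_
  have hr (k : ℕ) : ‖cauchyTerm y Q (k + 1)‖ / ‖cauchyTerm y Q k‖ =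
      y * (Q ^ k * Q ^ k) / ((1 - Q * Q ^ k) * (1 - y * Q ^ k)) := by
    rw [Real.norm_of_nonneg (pos _).le, Real.norm_of_nonneg (pos _).le]
    have e2 : Q ^ ((k + 1) * k) = Q ^ k * Q ^ k * Q ^ (k * (k - 1)) := by
      cases k with
      | zero => simp
      | succ k => simp only [Nat.add_sub_cancel]; ring
    have a1 := (p1 k).ne'
    have a2 := (p2 k).ne'
    have a3 := (p1 (k + 1)).ne'
    have a4 := (p2 (k + 1)).ne'
    simp only [cauchyTerm, Nat.add_sub_cancel, e2]
    rw [qPoch_succ] at a3 a4 ⊢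
    rw [qPoch_succ, pow_succ']
    have a5 := right_ne_zero_of_mul a3
    have a6 := right_ne_zero_of_mul a4
    field_simp
  simp only [hr]
  have hp := tendsto_pow_atTop_nhds_zero_of_lt_one hQ0.le hQ
  have := ((hp.mul hp).const_mul y).div
    (((hp.const_mul Q).const_sub 1).mul ((hp.const_mul y).const_sub 1)) (by simp)
  simpa [Pi.div_def] using this

lemma tendsto_qPoch {y Q : ℝ} (hQ0 : 0 ≤ Q) (hQ : Q < 1) :
    Filter.Tendsto (qPoch y Q) Filter.atTop (nhds (∏' i : ℕ, (1 - y * Q ^ i))) := by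
  have : Multipliable fun i : ℕ => 1 + -(y * Q ^ i) :=
    Real.multipliable_one_add_of_summable
      ((summable_geometric_of_lt_one hQ0 hQ).mul_left y).neg
  simpa [sub_eq_add_neg, funext fun n => qPoch.eq_1 y Q n] using this.hasProd.tendsto_prod_nat

/-- Cauchy's identity: the limit `n → ∞` of the `q`-Vandermonde identity. -/
lemma tprod_mul_tsum_cauchyTerm {y Q : ℝ} (hy : y < 1) (hy0 : 0 < y) (hQ0 : 0 < Q)
    (hQ : Q < 1) : (∏' i : ℕ, (1 - y * Q ^ i)) * ∑' k, cauchyTerm y Q k = 1 := by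
  have p1 (k) := qPoch_pos hy hy0.le hQ0.le hQ k
  have p2 (k) := qPoch_pos hQ hQ0.le hQ0.le hQ k
  -- the summand of the finite identity, extended by `0` to `k > n`
  let f : ℕ → ℕ → ℝ := fun n k =>
    if k ≤ n then qPoch Q Q n * vandermondeTerm y Q k (n - k) else 0
  have hf {n k : ℕ} (h : k ≤ n) : f n k =
      qPoch y Q n * qPoch (Q * Q ^ (n - k)) Q k * cauchyTerm y Q k := by
    obtain ⟨m, rfl⟩ := Nat.exists_eq_add_of_le h
    have e1 := qPoch_add y Q k m
    have e2 := qPoch_add Q Q m k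
    have := (p1 k).ne'
    have := (p2 k).ne'
    have := (p2 m).ne'
    simp only [f, if_pos h, Nat.add_sub_cancel_left, e1, vandermondeTerm, cauchyTerm]
    rw [add_comm k m, e2]
    field_simp
  have hsum (n : ℕ) : ∑' k, f n k = 1 := by
    rw [tsum_eq_sum (s := Finset.range (n + 1)), ← sum_range_vandermondeTerm hQ0.le hQ n y]
    · refine Finset.sum_congr rfl fun k hk => ?_
      simp only [f, if_pos (Nat.lt_succ_iff.1 (Finset.mem_range.1 hk))]
    · intro k hk
      simp only [Finset.mem_range, not_lt] at hk
      simp only [f, if_neg (by omega : ¬ k ≤ n)]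
  have hlim := tendsto_tsum_of_dominated_convergence (𝓕 := Filter.atTop) (f := f)
    (g := fun k => (∏' i : ℕ, (1 - y * Q ^ i)) * 1 * cauchyTerm y Q k)
    (summable_cauchyTerm hy hy0 hQ0 hQ) ?_ ?_
  · simp only [hsum, mul_one, tsum_mul_left] at hlim
    exact tendsto_nhds_unique hlim tendsto_const_nhds
  · intro k
    have hk : Filter.Tendsto (fun n => qPoch (Q * Q ^ (n - k)) Q k) Filter.atTop (nhds 1) := by
      have : Filter.Tendsto (fun n => Q * Q ^ (n - k)) Filter.atTop (nhds 0) := by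
        simpa using ((tendsto_pow_atTop_nhds_zero_of_lt_one hQ0.le hQ).comp
          (Filter.tendsto_sub_atTop_nat k)).const_mul Q
      have h2 := tendsto_finsetProd (Finset.range k)
        (fun i _ => (this.mul_const (Q ^ i)).const_sub 1)
      simpa [qPoch] using h2
    refine (((tendsto_qPoch hQ0.le hQ).mul hk).mul_const _).congr' ?_
    filter_upwards [Filter.eventually_ge_atTop k] with n hn using (hf hn).symm
  · refine Filter.Eventually.of_forall fun n k => ?_
    have hc := cauchyTerm_nonneg hy hy0.le hQ0.le hQ k
    by_cases h : k ≤ n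
    · have hz : Q * Q ^ (n - k) < 1 := by
        rw [← pow_succ']; exact pow_lt_one₀ hQ0.le hQ (Nat.succ_ne_zero _)
      have hz0 : 0 ≤ Q * Q ^ (n - k) := by positivity
      have b0 := qPoch_pos hz hz0 hQ0.le hQ k
      have b1 := qPoch_le_one hz hz0 hQ0.le hQ k
      have b2 := qPoch_le_one hy hy0.le hQ0.le hQ n
      rw [hf h, Real.norm_of_nonneg (mul_nonneg (mul_nonneg (p1 n).le b0.le) hc)]
      exact mul_le_of_le_one_left hc (mul_le_one₀ b2 b0.le b1)
    · simpa [f, h] using hc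

lemma hasSum_cauchyTerm {y Q : ℝ} (hy : y < 1) (hy0 : 0 < y) (hQ0 : 0 < Q) (hQ : Q < 1) :
    HasSum (fun k => (∏' i : ℕ, (1 - y * Q ^ i)) * cauchyTerm y Q k) 1 := by
  have := (summable_cauchyTerm hy hy0 hQ0 hQ).hasSum.mul_left (∏' i : ℕ, (1 - y * Q ^ i))
  rwa [tprod_mul_tsum_cauchyTerm hy hy0 hQ0 hQ] at this

lemma tprod_qPoch_nonneg {y Q : ℝ} (hy : y < 1) (hy0 : 0 ≤ y) (hQ0 : 0 ≤ Q) (hQ : Q < 1) :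
    0 ≤ ∏' i : ℕ, (1 - y * Q ^ i) :=
  ge_of_tendsto' (tendsto_qPoch hQ0 hQ) fun n => (qPoch_pos hy hy0 hQ0 hQ n).le

lemma tprod_qPoch_succ {y Q : ℝ} (hQ0 : 0 ≤ Q) (hQ : Q < 1) :
    ∏' i : ℕ, (1 - y * Q ^ i) = (1 - y) * ∏' i : ℕ, (1 - y * Q * Q ^ i) := by
  refine tendsto_nhds_unique ((tendsto_qPoch hQ0 hQ).comp (Filter.tendsto_add_atTop_nat 1)) ?_
  refine ((tendsto_qPoch (y := y * Q) hQ0 hQ).const_mul (1 - y)).congr fun n => ?_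
  exact (qPoch_succ_left y Q n).symm

/-! ### Closed forms of the kernels -/

lemma choose_two_even (k : ℕ) : (2 * k).choose 2 + k = 2 * k ^ 2 := by
  induction k with
  | zero => rfl
  | succ k ih =>
    rw [show 2 * (k + 1) = 2 * k + 1 + 1 by ring, Nat.choose_succ_succ' (2 * k + 1) 1,
      Nat.choose_succ_succ' (2 * k) 1]
    simp only [Nat.choose_one_right]
    linarith

lemma choose_two_odd (k : ℕ) : (2 * k + 1).choose 2 = 2 * k ^ 2 + k := by
  rw [Nat.choose_succ_succ' (2 * k) 1, Nat.choose_one_right, ← choose_two_even]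
  ring

variable {q : ℕ} {u : ℝ}

/-- The weight `u^b / q^(b choose 2)` that a column of length `b` carries in every position. -/
noncomputable def colMass (q : ℕ) (u : ℝ) (b : ℕ) : ℝ := u ^ b / (q : ℝ) ^ b.choose 2

/-- The product `(1 - 1/q²) (1 - 1/q⁴) ⋯ (1 - 1/q^(2m))`. -/
noncomputable def evenPoch (q m : ℕ) : ℝ := qPoch ((q : ℝ) ^ 2)⁻¹ ((q : ℝ) ^ 2)⁻¹ m

lemma evenPoch_eq_prod (q m : ℕ) :
    evenPoch q m = ∏ j ∈ Finset.Icc 1 m, (1 - 1 / (q : ℝ) ^ (2 * j)) := by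
  induction m with
  | zero => simp [evenPoch]
  | succ m ih =>
    rw [Finset.prod_Icc_succ_top (by omega), ← ih, evenPoch, qPoch_succ, ← pow_succ', one_div,
      pow_mul, evenPoch, inv_pow _ (m + 1)]

lemma sq_inv_lt_one (hq : 2 ≤ q) : ((q : ℝ) ^ 2)⁻¹ < 1 := by
  have : (2 : ℝ) ≤ q := by exact_mod_cast hq
  exact inv_lt_one_of_one_lt₀ (by nlinarith)

lemma sq_inv_pos (hq : 2 ≤ q) : 0 < ((q : ℝ) ^ 2)⁻¹ := by
  have : (2 : ℝ) ≤ q := by exact_mod_cast hq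
  positivity

lemma evenPoch_pos (hq : 2 ≤ q) (m : ℕ) : 0 < evenPoch q m :=
  qPoch_pos (sq_inv_lt_one hq) (sq_inv_pos hq).le (sq_inv_pos hq).le (sq_inv_lt_one hq) m

lemma evenProd_eq (hq : 2 ≤ q) (m : ℕ) :
    evenProd q m = (q : ℝ) ^ (m * (m + 1)) * evenPoch q m := by
  have h0 : (q : ℝ) ≠ 0 := by positivity
  induction m with
  | zero => simp [evenProd, evenPoch]
  | succ m ih =>
    have e := Finset.prod_Icc_succ_top (by omega : 1 ≤ m + 1) (fun j => ((q : ℝ) ^ (2 * j) - 1))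
    rw [evenProd, e, ← evenProd, ih, evenPoch_eq_prod, evenPoch_eq_prod,
      Finset.prod_Icc_succ_top (by omega)]
    field_simp
    ring

lemma altProd_succ (a : ℕ) : altProd q u (a + 1) =
    altProd q u a * if Odd (a + 1) then 1 - u ^ 2 / (q : ℝ) ^ (a + 1)
      else 1 - 1 / (q : ℝ) ^ (a + 1) :=
  Finset.prod_Icc_succ_top (by omega) _

lemma altProd_odd (hq : 2 ≤ q) (k : ℕ) : altProd q u (2 * k + 1) =
    altProd q u (2 * k) * (1 - u ^ 2 / q * ((q : ℝ) ^ 2)⁻¹ ^ k) := by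
  have h0 : (q : ℝ) ≠ 0 := by positivity
  rw [altProd_succ, if_pos (by simp)]
  congr 2
  rw [inv_pow, ← pow_mul, ← div_eq_mul_inv, div_div, ← pow_succ']

lemma altProd_even (hq : 2 ≤ q) (k : ℕ) : altProd q u (2 * k) =
    qPoch (u ^ 2 / q) ((q : ℝ) ^ 2)⁻¹ k * evenPoch q k := by
  induction k with
  | zero => simp [altProd, evenPoch]
  | succ k ih =>
    rw [show 2 * (k + 1) = 2 * k + 1 + 1 by ring, altProd_succ,
      if_neg (by simp [Nat.even_add_one]), altProd_odd hq, ih, qPoch_succ, evenPoch, evenPoch,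
      qPoch_succ, ← pow_succ', inv_pow _ (k + 1), ← pow_mul, one_div, mul_add_one, add_assoc]
    ring

lemma div_lt_one_of_sq (hq : 2 ≤ q) (hu : u ^ 2 < q) : u ^ 2 / q < 1 := by
  rw [div_lt_one (by positivity)]
  exact hu

lemma altProd_odd' (hq : 2 ≤ q) (k : ℕ) : altProd q u (2 * k + 1) =
    qPoch (u ^ 2 / q) ((q : ℝ) ^ 2)⁻¹ (k + 1) * evenPoch q k := by
  rw [altProd_odd hq, altProd_even hq, qPoch_succ]
  ring

lemma altProd_pos (hq : 2 ≤ q) (hu : u ^ 2 < q) (a : ℕ) : 0 < altProd q u a := by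
  have h (k) := qPoch_pos (div_lt_one_of_sq hq hu) (by positivity) (sq_inv_pos hq).le
    (sq_inv_lt_one hq) k
  obtain ⟨k, rfl | rfl⟩ := Nat.even_or_odd' a
  · rw [altProd_even hq]
    exact mul_pos (h k) (evenPoch_pos hq k)
  · rw [altProd_odd' hq]
    exact mul_pos (h _) (evenPoch_pos hq k)

lemma colMass_pos (hq : 2 ≤ q) (hu0 : 0 < u) (b : ℕ) : 0 < colMass q u b := by
  have : 0 < (q : ℝ) := by positivity
  unfold colMass
  positivity

lemma PO_eq (b : ℕ) : PO q u b = colMass q u b / altProd q u b := by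
  obtain ⟨k, rfl | rfl⟩ := Nat.even_or_odd' b
  · simp [PO, colMass, div_div, ← choose_two_even]
  · simp [PO, colMass, div_div, choose_two_odd, Nat.add_div]

lemma PSp_eq (hq : 2 ≤ q) (b : ℕ) :
    PSp q u b = colMass q u b * u ^ (b % 2) / ((q : ℝ) ^ b * altProd q u b) := by
  have h0 : (q : ℝ) ≠ 0 := by positivity
  obtain ⟨k, rfl | rfl⟩ := Nat.even_or_odd' b
  · simp only [PSp, colMass, even_two_mul, if_true, Nat.mul_div_cancel_left k two_pos,
      Nat.mul_mod_right, pow_zero, ← choose_two_even]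
    rw [div_mul_eq_mul_div, div_div, mul_one]
    congr 1
    ring
  · have h2 : (2 * k + 1) / 2 = k := by omega
    have h3 : (2 * k + 1) % 2 = 1 := by omega
    simp only [PSp, colMass, h2, h3, choose_two_odd, Nat.even_add_one, even_two_mul, not_true,
      if_false]
    rw [div_mul_eq_mul_div, div_div]
    congr 1 <;> ring

lemma initProb_eq (a : ℕ) : initProb q u a =
    normConst q u * (colMass q u a * u ^ (a % 2) / altProd q u a) := by
  obtain ⟨k, rfl | rfl⟩ := Nat.even_or_odd' a
  · simp [initProb, colMass, div_div, ← choose_two_even]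
  · have h2 : (2 * k + 1) / 2 = k := by omega
    have h3 : (2 * k + 1) % 2 = 1 := by omega
    simp only [initProb, colMass, h2, h3, choose_two_odd, Nat.even_add_one, even_two_mul, not_true,
      if_false]
    rw [div_mul_eq_mul_div, div_div]
    ring

lemma colMass_even (hq : 2 ≤ q) (k : ℕ) :
    colMass q u (2 * k) = u ^ (2 * k) * (q : ℝ) ^ k / (q : ℝ) ^ (2 * k ^ 2) := by
  have h0 : (q : ℝ) ≠ 0 := by positivity
  rw [colMass, ← choose_two_even, pow_add]
  field_simp

lemma colMass_odd (k : ℕ) :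
    colMass q u (2 * k + 1) = u ^ (2 * k + 1) / (q : ℝ) ^ (2 * k ^ 2 + k) := by
  rw [colMass, choose_two_odd]

lemma K1_eq (hq : 2 ≤ q) (hu0 : 0 < u) (hu : u ^ 2 < q) (b d : ℕ) : K1 q u (b + 2 * d) b =
    colMass q u b * altProd q u (b + 2 * d) /
      (altProd q u b * evenPoch q d * u ^ (b % 2)) := by
  have h0 : (q : ℝ) ≠ 0 := by positivity
  have hD := (altProd_pos hq hu b).ne'
  have hD' := (altProd_pos hq hu (b + 2 * d)).ne'
  have hE := (evenPoch_pos hq d).ne'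
  have hm : (b + 2 * d) % 2 = b % 2 := by omega
  rw [K1, if_pos ⟨by omega, by simp⟩, PO_eq, PSp_eq hq,
    show (b + 2 * d - b) / 2 = d by omega, evenProd_eq hq, hm]
  obtain ⟨k, rfl | rfl⟩ := Nat.even_or_odd' b
  · have e : ((((2 * k + 2 * d : ℕ) : ℝ) ^ 2 - ((2 * k : ℕ) : ℝ) ^ 2 +
        2 * (((2 * k + 2 * d : ℕ) : ℝ) + 1) * ((2 * k : ℕ) : ℝ)) / 4) =
        ((d ^ 2 + 4 * k * d + 2 * k ^ 2 + k : ℕ) : ℝ) := by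
      push_cast; ring
    rw [e, Real.rpow_natCast, colMass_even hq, ← mul_add, colMass_even hq]
    rw [← mul_add] at hD'
    field_simp
    ring
  · have e : ((((2 * k + 1 + 2 * d : ℕ) : ℝ) ^ 2 - ((2 * k + 1 : ℕ) : ℝ) ^ 2 +
        2 * (((2 * k + 1 + 2 * d : ℕ) : ℝ) + 1) * ((2 * k + 1 : ℕ) : ℝ)) / 4) =
        ((d ^ 2 + 4 * k * d + 2 * k ^ 2 + 3 * k + 2 * d + 1 : ℕ) : ℝ) := by
      push_cast; ring
    have e1 : 2 * k + 1 + 2 * d = 2 * (k + d) + 1 := by ring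
    rw [e, Real.rpow_natCast, colMass_odd, e1, colMass_odd]
    rw [e1] at hD'
    field_simp
    ring

lemma K2_eq (hq : 2 ≤ q) (hu0 : 0 < u) (hu : u ^ 2 < q) {a b : ℕ} (hab : b ≤ a) : K2 q u a b =
    colMass q u b * u ^ (b % 2) * altProd q u a /
      ((q : ℝ) ^ b * altProd q u b * evenPoch q ((a - b) / 2)) := by
  have h0 : (q : ℝ) ≠ 0 := by positivity
  have hD := (altProd_pos hq hu b).ne'
  have hD' := (altProd_pos hq hu a).ne'
  have hE := (evenPoch_pos hq ((a - b) / 2)).ne'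
  obtain ⟨d, hd | hd⟩ := Nat.even_or_odd' (a - b)
  · obtain rfl : a = b + 2 * d := by omega
    have hd2 : 2 * d / 2 = d := by omega
    rw [hd, hd2] at hE ⊢
    rw [K2, if_pos hab, hd, if_pos (by simp), PO_eq, PSp_eq hq, hd2, evenProd_eq hq,
      Real.rpow_sub (by positivity), Real.rpow_natCast]
    have e1 : (((b + 2 * d : ℕ) : ℝ) - b) ^ 2 / 4 = ((d ^ 2 : ℕ) : ℝ) := by push_cast; ring
    rw [e1, Real.rpow_natCast]
    obtain ⟨k, rfl | rfl⟩ := Nat.even_or_odd' b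
    · have e : ((((2 * k + 2 * d : ℕ) : ℝ) ^ 2 + ((2 * k : ℕ) : ℝ)) / 2) =
          ((2 * (k + d) ^ 2 + k : ℕ) : ℝ) := by push_cast; ring
      rw [e, Real.rpow_natCast, colMass_even hq, ← mul_add, colMass_even hq]
      rw [← mul_add] at hD'
      field_simp
      ring
    · have e : ((((2 * k + 1 + 2 * d : ℕ) : ℝ) ^ 2 + ((2 * k + 1 : ℕ) : ℝ)) / 2) =
          ((2 * (k + d) ^ 2 + 2 * (k + d) + k + 1 : ℕ) : ℝ) := by push_cast; ring
      have e1 : 2 * k + 1 + 2 * d = 2 * (k + d) + 1 := by ring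
      rw [e, Real.rpow_natCast, colMass_odd, e1, colMass_odd]
      rw [e1] at hD'
      field_simp
      ring
  · obtain rfl : a = b + 2 * d + 1 := by omega
    have hd2 : (2 * d + 1) / 2 = d := by omega
    have hd3 : (2 * d + 1 - 1) / 2 = d := by omega
    rw [hd, hd2] at hE ⊢
    rw [K2, if_pos hab, hd, if_neg (by simp), PO_eq, PSp_eq hq, hd3, evenProd_eq hq]
    have e1 : ((((b + 2 * d + 1 : ℕ) : ℝ) - b) ^ 2 - 1) / 4 = ((d ^ 2 + d : ℕ) : ℝ) := by
      push_cast; ring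
    have e2 : (((b + 2 * d + 1 : ℕ) : ℝ) ^ 2 - ((b + 2 * d + 1 : ℕ) : ℝ)) / 2 =
        (((b + 2 * d + 1).choose 2 : ℕ) : ℝ) := by
      rw [Nat.cast_choose_two]; ring
    rw [e1, e2, Real.rpow_natCast, Real.rpow_natCast, colMass, colMass]
    field_simp
    ring

lemma colMass_even_eq (hq : 2 ≤ q) (k : ℕ) :
    colMass q u (2 * k) = (u ^ 2 / q) ^ k * ((q : ℝ) ^ 2)⁻¹ ^ (k * (k - 1)) := by
  have h0 : (q : ℝ) ≠ 0 := by positivity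
  rw [colMass_even hq, inv_pow, ← pow_mul, div_pow, ← pow_mul]
  have e : 2 * k ^ 2 = 2 * (k * (k - 1)) + 2 * k := by
    cases k with
    | zero => rfl
    | succ k => simp only [Nat.add_sub_cancel]; ring
  rw [e, pow_add]
  field_simp
  ring

lemma colMass_even_div (hq : 2 ≤ q) (k : ℕ) :
    colMass q u (2 * k) / (q : ℝ) ^ (2 * k) =
      (u ^ 2 / q * ((q : ℝ) ^ 2)⁻¹) ^ k * ((q : ℝ) ^ 2)⁻¹ ^ (k * (k - 1)) := by
  rw [colMass_even_eq hq, mul_pow, inv_pow _ k, ← pow_mul]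
  ring

lemma colMass_odd_eq (hq : 2 ≤ q) (k : ℕ) : colMass q u (2 * k + 1) =
    u * ((u ^ 2 / q * ((q : ℝ) ^ 2)⁻¹) ^ k * ((q : ℝ) ^ 2)⁻¹ ^ (k * (k - 1))) := by
  have h0 : (q : ℝ) ≠ 0 := by positivity
  rw [← colMass_even_div hq, colMass_odd, colMass_even hq, pow_add _ (2 * k ^ 2) k]
  field_simp
  ring

/-! ### The kernels and the initial law are probability distributions -/

lemma K1_eq_zero {a b : ℕ} (h : ¬ (b ≤ a ∧ Even (a - b))) : K1 q u a b = 0 := if_neg h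

lemma K2_eq_zero {a b : ℕ} (h : a < b) : K2 q u a b = 0 := if_neg (by omega)

lemma K1_pos (hq : 2 ≤ q) (hu0 : 0 < u) (hu : u ^ 2 < q) (b d : ℕ) :
    0 < K1 q u (b + 2 * d) b := by
  rw [K1_eq hq hu0 hu]
  have := altProd_pos hq hu b
  have := altProd_pos hq hu (b + 2 * d)
  have := evenPoch_pos hq d
  have := colMass_pos hq hu0 b
  positivity

lemma K2_pos (hq : 2 ≤ q) (hu0 : 0 < u) (hu : u ^ 2 < q) {a b : ℕ} (hab : b ≤ a) :
    0 < K2 q u a b := by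
  rw [K2_eq hq hu0 hu hab]
  have := altProd_pos hq hu b
  have := altProd_pos hq hu a
  have := evenPoch_pos hq ((a - b) / 2)
  have := colMass_pos hq hu0 b
  positivity

lemma K1_nonneg (hq : 2 ≤ q) (hu0 : 0 < u) (hu : u ^ 2 < q) (a b : ℕ) : 0 ≤ K1 q u a b := by
  by_cases h : b ≤ a ∧ Even (a - b)
  · obtain ⟨d, hd⟩ := h.2
    obtain rfl : a = b + 2 * d := by omega
    exact (K1_pos hq hu0 hu b d).le
  · exact (K1_eq_zero h).ge

lemma K2_nonneg (hq : 2 ≤ q) (hu0 : 0 < u) (hu : u ^ 2 < q) (a b : ℕ) : 0 ≤ K2 q u a b := by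
  rcases le_or_gt b a with h | h
  · exact (K2_pos hq hu0 hu h).le
  · exact (K2_eq_zero h).ge

lemma sum_range_two_mul (f : ℕ → ℝ) (n : ℕ) :
    ∑ b ∈ Finset.range (2 * n), f b = ∑ k ∈ Finset.range n, (f (2 * k) + f (2 * k + 1)) := by
  induction n with
  | zero => simp
  | succ n ih =>
    rw [mul_add_one, Finset.sum_range_succ, Finset.sum_range_succ, Finset.sum_range_succ, ih,
      add_assoc]

/-- A row whose entries, taken in consecutive pairs, are the normalised `q`-Vandermonde summands,
sums to `1`. -/
lemma hasSum_of_pairs (hq : 2 ≤ q) (y : ℝ) (A : ℕ) (f : ℕ → ℝ)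
    (h0 : ∀ b, 2 * A + 2 ≤ b → f b = 0)
    (h : ∀ k d, k + d = A → f (2 * k) + f (2 * k + 1) =
      evenPoch q (k + d) * vandermondeTerm y ((q : ℝ) ^ 2)⁻¹ k d) : HasSum f 1 := by
  have : ∑ b ∈ Finset.range (2 * (A + 1)), f b = 1 := by
    rw [sum_range_two_mul,
      ← sum_range_vandermondeTerm (sq_inv_pos hq).le (sq_inv_lt_one hq) A y]
    refine Finset.sum_congr rfl fun k hk => ?_
    have hk := Finset.mem_range.1 hk
    rw [h k (A - k) (by omega), show k + (A - k) = A by omega, evenPoch]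
  rw [← this]
  refine hasSum_sum_of_ne_finset_zero fun b hb => h0 b ?_
  simp only [Finset.mem_range, not_lt] at hb
  omega

lemma hasSum_K1 (hq : 2 ≤ q) (hu0 : 0 < u) (hu : u ^ 2 < q) (a : ℕ) :
    HasSum (K1 q u a) 1 := by
  have hE (m) := (evenPoch_pos hq m).ne'
  have hP (m) := (qPoch_pos (div_lt_one_of_sq hq hu) (by positivity) (sq_inv_pos hq).le
    (sq_inv_lt_one hq) m).ne'
  obtain ⟨A, rfl | rfl⟩ := Nat.even_or_odd' a
  · refine hasSum_of_pairs hq (u ^ 2 / q) A _ (fun b hb => K1_eq_zero (by omega)) ?_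
    rintro k d rfl
    rw [K1_eq_zero (b := 2 * k + 1) (by grind), add_zero, mul_add, K1_eq hq hu0 hu, ← mul_add,
      altProd_even hq, altProd_even hq, colMass_even_eq hq, Nat.mul_mod_right, pow_zero,
      vandermondeTerm, qPoch_add, ← evenPoch, ← evenPoch]
    have := hE k; have := hE d; have := hP k
    generalize ((q : ℝ) ^ 2)⁻¹ = Q at *
    field_simp
  · refine hasSum_of_pairs hq (u ^ 2 / q * ((q : ℝ) ^ 2)⁻¹) A _
      (fun b hb => K1_eq_zero (by omega)) ?_
    rintro k d rfl
    rw [K1_eq_zero (b := 2 * k) (by grind), zero_add,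
      show 2 * (k + d) + 1 = 2 * k + 1 + 2 * d by ring, K1_eq hq hu0 hu,
      show 2 * k + 1 + 2 * d = 2 * (k + d) + 1 by ring,
      altProd_odd' hq, altProd_odd' hq, colMass_odd_eq hq, show (2 * k + 1) % 2 = 1 by omega,
      pow_one, vandermondeTerm, show k + d + 1 = k + 1 + d by ring, qPoch_add _ _ (k + 1),
      ← evenPoch, ← evenPoch, mul_assoc (u ^ 2 / (q : ℝ)) _ (_ ^ k), ← pow_succ']
    have := hE k; have := hE d; have := hP (k + 1)
    generalize ((q : ℝ) ^ 2)⁻¹ = Q at *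
    field_simp

lemma K2_even_eq (hq : 2 ≤ q) (hu0 : 0 < u) (hu : u ^ 2 < q) {a k : ℕ} (h : 2 * k ≤ a) :
    K2 q u a (2 * k) = (u ^ 2 / q * ((q : ℝ) ^ 2)⁻¹) ^ k * ((q : ℝ) ^ 2)⁻¹ ^ (k * (k - 1)) *
      altProd q u a / (altProd q u (2 * k) * evenPoch q ((a - 2 * k) / 2)) := by
  rw [K2_eq hq hu0 hu h, ← colMass_even_div hq, Nat.mul_mod_right]
  ring

lemma K2_odd_eq (hq : 2 ≤ q) (hu0 : 0 < u) (hu : u ^ 2 < q) {a k : ℕ} (h : 2 * k + 1 ≤ a) :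
    K2 q u a (2 * k + 1) = u ^ 2 / q * ((q : ℝ) ^ 2)⁻¹ ^ k *
      ((u ^ 2 / q * ((q : ℝ) ^ 2)⁻¹) ^ k * ((q : ℝ) ^ 2)⁻¹ ^ (k * (k - 1))) *
      altProd q u a / (altProd q u (2 * k + 1) * evenPoch q ((a - (2 * k + 1)) / 2)) := by
  rw [K2_eq hq hu0 hu h, colMass_odd_eq hq, show (2 * k + 1) % 2 = 1 by omega, inv_pow _ k,
    ← pow_mul]
  ring

/-- The entries at `2k` and `2k+1` add up to the `k`-th `q`-Vandermonde summand at `yQ = u²/q³`. -/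
lemma hasSum_K2 (hq : 2 ≤ q) (hu0 : 0 < u) (hu : u ^ 2 < q) (a : ℕ) :
    HasSum (K2 q u a) 1 := by
  have hE (m) := (evenPoch_pos hq m).ne'
  have hP (m) := (qPoch_pos (div_lt_one_of_sq hq hu) (by positivity) (sq_inv_pos hq).le
    (sq_inv_lt_one hq) m).ne'
  obtain ⟨A, rfl | rfl⟩ := Nat.even_or_odd' a
  · refine hasSum_of_pairs hq (u ^ 2 / q * ((q : ℝ) ^ 2)⁻¹) A _
      (fun b hb => K2_eq_zero (by omega)) ?_
    rintro k d rfl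
    rw [K2_even_eq hq hu0 hu (by omega), show (2 * (k + d) - 2 * k) / 2 = d by omega,
      altProd_even hq, altProd_even hq, vandermondeTerm, ← evenPoch, ← evenPoch,
      mul_assoc (u ^ 2 / (q : ℝ)) _ (_ ^ k), ← pow_succ']
    cases d with
    | zero =>
      rw [K2_eq_zero (by omega)]
      have := hE k; have := hP k
      generalize ((q : ℝ) ^ 2)⁻¹ = Q at *
      simp only [add_zero, qPoch_zero]
      field_simp
    | succ d =>
      rw [K2_odd_eq hq hu0 hu (by omega),
        show (2 * (k + (d + 1)) - (2 * k + 1)) / 2 = d by omega, altProd_even hq, altProd_odd' hq,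
        show k + (d + 1) = k + 1 + d by ring, qPoch_add, qPoch_succ _ _ d]
      have hs : evenPoch q (d + 1) = evenPoch q d * (1 - ((q : ℝ) ^ 2)⁻¹ ^ (d + 1)) := by
        rw [evenPoch, evenPoch, qPoch_succ, pow_succ' _ d]
      have h1 := hE (d + 1)
      have h2 := hP (k + 1)
      rw [hs] at h1 ⊢
      rw [qPoch_succ] at h2 ⊢
      have := left_ne_zero_of_mul h1
      have := right_ne_zero_of_mul h1
      have := left_ne_zero_of_mul h2
      have := right_ne_zero_of_mul h2
      have := hE k
      generalize ((q : ℝ) ^ 2)⁻¹ = Q at *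
      generalize u ^ 2 / (q : ℝ) = y at *
      field_simp
      ring
  · refine hasSum_of_pairs hq (u ^ 2 / q * ((q : ℝ) ^ 2)⁻¹) A _
      (fun b hb => K2_eq_zero (by omega)) ?_
    rintro k d rfl
    rw [K2_even_eq hq hu0 hu (by omega), K2_odd_eq hq hu0 hu (by omega),
      show (2 * (k + d) + 1 - 2 * k) / 2 = d by omega,
      show (2 * (k + d) + 1 - (2 * k + 1)) / 2 = d by omega,
      altProd_even hq, altProd_odd' hq, altProd_odd' hq, vandermondeTerm, ← evenPoch, ← evenPoch,
      mul_assoc (u ^ 2 / (q : ℝ)) _ (_ ^ k), ← pow_succ', show k + d + 1 = k + 1 + d by ring,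
      qPoch_add]
    have h2 := hP (k + 1)
    rw [qPoch_succ] at h2 ⊢
    have := left_ne_zero_of_mul h2
    have := right_ne_zero_of_mul h2
    have := hE k; have := hE d
    generalize ((q : ℝ) ^ 2)⁻¹ = Q at *
    generalize u ^ 2 / (q : ℝ) = y at *
    field_simp
    ring

lemma normConst_eq (q : ℕ) (u : ℝ) : normConst q u =
    (∏' i : ℕ, (1 - u ^ 2 / q * ((q : ℝ) ^ 2)⁻¹ ^ i)) / (1 + u ^ 2) := by
  rw [normConst]
  congr 2 with i
  rw [inv_pow, ← pow_mul, ← div_eq_mul_inv, div_div, ← pow_succ']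

lemma normConst_nonneg (hq : 2 ≤ q) (hu : u ^ 2 < q) : 0 ≤ normConst q u := by
  rw [normConst_eq]
  have := tprod_qPoch_nonneg (div_lt_one_of_sq hq hu) (by positivity) (sq_inv_pos hq).le
    (sq_inv_lt_one hq)
  positivity

lemma initProb_nonneg (hq : 2 ≤ q) (hu0 : 0 < u) (hu : u ^ 2 < q) (a : ℕ) :
    0 ≤ initProb q u a := by
  rw [initProb_eq]
  have := normConst_nonneg hq hu
  have := altProd_pos hq hu a
  have := colMass_pos hq hu0 a
  positivity

/-- Both halves of the initial law are Cauchy sums: the even values at `y = u²/q` with total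
`1/(1+u²)`, the odd values at `yQ = u²/q³` with total `u²/(1+u²)`. -/
lemma hasSum_initProb (hq : 2 ≤ q) (hu0 : 0 < u) (hu : u ^ 2 < q) :
    HasSum (initProb q u) 1 := by
  have h0 : (0 : ℝ) < q := by positivity
  have hy := div_lt_one_of_sq hq hu
  have hy0 : 0 < u ^ 2 / (q : ℝ) := by positivity
  have hQ0 := sq_inv_pos hq
  have hQ := sq_inv_lt_one hq
  have hyQ0 := mul_pos hy0 hQ0
  have hyQ : u ^ 2 / (q : ℝ) * ((q : ℝ) ^ 2)⁻¹ < 1 :=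
    mul_lt_one_of_nonneg_of_lt_one_left hy0.le hy hQ.le
  have hE (m) := (evenPoch_pos hq m).ne'
  have hP (m) := (qPoch_pos hy hy0.le hQ0.le hQ m).ne'
  have h1 : (1 + u ^ 2) ≠ 0 := by positivity
  have even := (hasSum_cauchyTerm hy hy0 hQ0 hQ).mul_left (1 / (1 + u ^ 2))
  have odd := (hasSum_cauchyTerm hyQ hyQ0 hQ0 hQ).mul_left (u ^ 2 / (1 + u ^ 2))
  have e1 (k : ℕ) : initProb q u (2 * k) = 1 / (1 + u ^ 2) *
      ((∏' i : ℕ, (1 - u ^ 2 / q * ((q : ℝ) ^ 2)⁻¹ ^ i)) *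
        cauchyTerm (u ^ 2 / q) ((q : ℝ) ^ 2)⁻¹ k) := by
    rw [initProb_eq, normConst_eq, colMass_even_eq hq, Nat.mul_mod_right, altProd_even hq,
      cauchyTerm, ← evenPoch]
    ring
  have e2 (k : ℕ) : initProb q u (2 * k + 1) = u ^ 2 / (1 + u ^ 2) *
      ((∏' i : ℕ, (1 - u ^ 2 / q * ((q : ℝ) ^ 2)⁻¹ * ((q : ℝ) ^ 2)⁻¹ ^ i)) *
        cauchyTerm (u ^ 2 / q * ((q : ℝ) ^ 2)⁻¹) ((q : ℝ) ^ 2)⁻¹ k) := by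
    have h2 : 1 - u ^ 2 / (q : ℝ) ≠ 0 := (sub_pos.2 hy).ne'
    rw [initProb_eq, normConst_eq, tprod_qPoch_succ hQ0.le hQ, colMass_odd_eq hq,
      show (2 * k + 1) % 2 = 1 by omega, altProd_odd' hq, qPoch_succ_left, cauchyTerm, ← evenPoch]
    have := hE k
    have h3 := hP (k + 1)
    rw [qPoch_succ_left] at h3
    have := right_ne_zero_of_mul h3
    generalize ((q : ℝ) ^ 2)⁻¹ = Q at *
    generalize (∏' i : ℕ, (1 - u ^ 2 / q * Q * Q ^ i)) = Z at *
    generalize u ^ 2 / (q : ℝ) = y at *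
    field_simp
  rw [show (1 : ℝ) = 1 / (1 + u ^ 2) * 1 + u ^ 2 / (1 + u ^ 2) * 1 by field_simp]
  refine HasSum.even_add_odd ?_ ?_
  · simpa only [e1] using even
  · simpa only [e2] using odd

/-! ### Partitions and their column lengths -/

lemma countP_le_eq_count_add (s : Multiset ℕ) (i : ℕ) :
    s.countP (fun x => i ≤ x) = s.count i + s.countP (fun x => i + 1 ≤ x) := by
  simp only [Multiset.count]
  induction s using Multiset.induction with
  | empty => simp
  | cons x s ih =>
    simp only [Multiset.countP_cons, ih]
    grind

lemma countP_replicate (p : ℕ → Prop) [DecidablePred p] (n a : ℕ) :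
    (Multiset.replicate n a).countP p = if p a then n else 0 := by
  rw [← Multiset.coe_replicate, Multiset.coe_countP, List.countP_replicate]
  simp

namespace Ptn

lemma pos_of_mem_parts (l : Ptn) {x : ℕ} (hx : x ∈ l.parts) : 0 < x := l.1.2.parts_pos hx

lemma sum_parts (l : Ptn) : l.parts.sum = l.size := l.1.2.parts_sum

lemma le_size (l : Ptn) {x : ℕ} (hx : x ∈ l.parts) : x ≤ l.size :=
  l.sum_parts ▸ Multiset.le_sum_of_mem hx

lemma col_eq_zero (l : Ptn) {i : ℕ} (hi : l.size < i) : l.col i = 0 := by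
  rw [col, Multiset.card_eq_zero, Multiset.filter_eq_nil]
  exact fun x hx h => absurd (l.le_size hx) (by omega)

lemma col_eq_mult_add (l : Ptn) (i : ℕ) : l.col i = l.mult i + l.col (i + 1) := by
  simp only [col, mult, ← Multiset.countP_eq_card_filter]
  exact countP_le_eq_count_add _ i

lemma mult_eq (l : Ptn) (i : ℕ) : l.mult i = l.col i - l.col (i + 1) := by
  rw [col_eq_mult_add]
  omega

lemma antitone_col (l : Ptn) : Antitone l.col :=
  antitone_nat_of_succ_le fun i => by rw [l.col_eq_mult_add i]; omega

lemma col_one (l : Ptn) : l.col 1 = l.length := by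
  rw [col, length, Multiset.filter_eq_self.2]
  exact fun x hx => l.pos_of_mem_parts hx

lemma even_col_sub (l : Ptn) {i : ℕ} (hi : Odd i) : Even (l.col i - l.col (i + 1)) :=
  l.mult_eq i ▸ l.2 i hi

/-- A partition is determined by its column lengths. -/
lemma ext_col {l l' : Ptn} (h : ∀ i, l.col (i + 1) = l'.col (i + 1)) : l = l' := by
  have hp : l.parts = l'.parts := by
    ext i
    rcases i with _ | i
    · rw [Multiset.count_eq_zero_of_notMem fun h => (l.pos_of_mem_parts h).ne rfl,
        Multiset.count_eq_zero_of_notMem fun h => (l'.pos_of_mem_parts h).ne rfl]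
    · change l.mult (i + 1) = l'.mult (i + 1)
      rw [mult_eq, mult_eq, h, h]
  obtain ⟨⟨n, p⟩, hl⟩ := l
  obtain ⟨⟨n', p'⟩, hl'⟩ := l'
  change p.parts = p'.parts at hp
  obtain rfl : n = n' := by rw [← p.parts_sum, ← p'.parts_sum, hp]
  obtain rfl : p = p' := Nat.Partition.ext hp
  rfl

/-- A nonincreasing sequence that is eventually zero is the sequence of column lengths of a
partition; its parts are `i + 1` with multiplicity `c i - c (i + 1)`. -/
lemma exists_col_eq {c : ℕ → ℕ} (hc : Antitone c) (heven : ∀ i, Even i → Even (c i - c (i + 1)))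
    {N : ℕ} (hN : c N = 0) : ∃ l : Ptn, ∀ i, c i = l.col (i + 1) := by
  let s : Multiset ℕ := ∑ i ∈ Finset.range N, Multiset.replicate (c i - c (i + 1)) (i + 1)
  have hs {x : ℕ} (hx : x ∈ s) : 0 < x := by
    obtain ⟨i, -, hi⟩ := Multiset.mem_sum.1 hx
    rw [Multiset.eq_of_mem_replicate hi]
    exact i.succ_pos
  have hcol (j : ℕ) : s.countP (fun x => j + 1 ≤ x) = c j := by
    have key (n : ℕ) : (∑ i ∈ Finset.range n,
        Multiset.replicate (c i - c (i + 1)) (i + 1)).countP (fun x => j + 1 ≤ x) =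
          c j - c (max j n) := by
      induction n with
      | zero => simp
      | succ n ih =>
        rw [Finset.sum_range_succ, Multiset.countP_add, ih, countP_replicate]
        have h1 := hc n.le_succ
        rcases lt_or_ge n j with h | h
        · rw [if_neg (by omega), max_eq_left h.le, max_eq_left (by omega), add_zero]
        · have h2 := hc h
          rw [if_pos (by omega), max_eq_right h, max_eq_right (by omega)]
          simp only [Nat.succ_eq_add_one] at h1
          omega
    have h0 : c (max j N) = 0 := Nat.le_zero.1 (hN ▸ hc (le_max_right j N))
    rw [key, h0, Nat.sub_zero]
  have hcount (j : ℕ) : s.count (j + 1) = c j - c (j + 1) := by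
    rw [← hcol j, ← hcol (j + 1)]
    rw [countP_le_eq_count_add s (j + 1), Nat.add_sub_cancel_right]
  refine ⟨⟨⟨s.sum, ⟨s, hs, rfl⟩⟩, fun i hi => ?_⟩, fun i => ?_⟩
  · obtain ⟨j, rfl⟩ : ∃ j, i = j + 1 := ⟨i - 1, by have := hi.pos; omega⟩
    change Even (s.count (j + 1))
    rw [hcount]
    exact heven j (by grind)
  · rw [← hcol, Multiset.countP_eq_card_filter]
    rfl

end Ptn

/-- Double counting of the cells of the diagram, where the cells of column `i` have weight `f i`. -/
lemma sum_mul_card_filter (f : ℕ → ℕ) {N : ℕ} (s : Multiset ℕ) (hs : ∀ x ∈ s, x ≤ N) :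
    ∑ i ∈ Finset.range N, f i * (s.filter (fun x => i + 1 ≤ x)).card =
      (s.map fun x => ∑ i ∈ Finset.range x, f i).sum := by
  induction s using Multiset.induction with
  | empty => simp
  | cons x s ih =>
    have hx : x ≤ N := hs x (Multiset.mem_cons_self x s)
    have h1 : ∑ i ∈ Finset.range x, f i =
        ∑ i ∈ Finset.range N, f i * if i + 1 ≤ x then 1 else 0 := by
      simp only [mul_ite, mul_one, mul_zero, ← Finset.sum_filter]
      congr 1
      ext i
      simp only [Finset.mem_range, Finset.mem_filter]
      omega
    rw [Multiset.map_cons, Multiset.sum_cons, ← ih fun y hy => hs y (Multiset.mem_cons_of_mem hy),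
      h1, ← Finset.sum_add_distrib]
    refine Finset.sum_congr rfl fun i _ => ?_
    simp only [← Multiset.countP_eq_card_filter, Multiset.countP_cons]
    ring

namespace Ptn

lemma sum_col (l : Ptn) {N : ℕ} (hN : l.size ≤ N) :
    ∑ i ∈ Finset.range N, l.col (i + 1) = l.size := by
  have := sum_mul_card_filter (fun _ => 1) l.parts fun x hx => (l.le_size hx).trans hN
  simpa [col, sum_parts] using this

/-- The columns in odd positions have total length `(|λ| + o(λ)) / 2`, since a part `x` meets
`⌈x / 2⌉` of them. -/
lemma two_mul_sum_odd_col (l : Ptn) {N : ℕ} (hN : l.size ≤ N) :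
    2 * ∑ i ∈ Finset.range N, (if Even i then l.col (i + 1) else 0) = l.size + l.numOdd := by
  have := sum_mul_card_filter (fun i => if Even i then 1 else 0) l.parts
    fun x hx => (l.le_size hx).trans hN
  simp only [ite_mul, one_mul, zero_mul] at this
  simp only [col, ← sum_parts, numOdd]
  rw [this, ← Multiset.countP_eq_card_filter]
  clear this
  have hx (x : ℕ) : 2 * ∑ i ∈ Finset.range x, (if Even i then 1 else 0) =
      x + if Odd x then 1 else 0 := by
    induction x with
    | zero => simp
    | succ x ih => rw [Finset.sum_range_succ, mul_add, ih]; grind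
  induction l.parts using Multiset.induction with
  | empty => simp
  | cons x s ih =>
    rw [Multiset.map_cons, Multiset.sum_cons, Multiset.sum_cons, Multiset.countP_cons, mul_add, ih,
      hx]
    ring

end Ptn

/-! ### The probability of a finite stretch of columns -/

/-- The probability that the procedure starts with the columns `c 0, …, c n`. -/
noncomputable def prefixProb (q : ℕ) (u : ℝ) (c : ℕ → ℕ) (n : ℕ) : ℝ :=
  initProb q u (c 0) * ∏ i ∈ Finset.range n, stepProb q u (i + 1) (c i) (c (i + 1))

lemma prefixProb_succ (c : ℕ → ℕ) (n : ℕ) : prefixProb q u c (n + 1) =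
    prefixProb q u c n * stepProb q u (n + 1) (c n) (c (n + 1)) := by
  rw [prefixProb, Finset.prod_range_succ, ← mul_assoc, ← prefixProb]

/-- In the product of the transition probabilities the factors `altProd` telescope, and so do the
powers of `u` that record parities. -/
lemma prefixProb_eq (hq : 2 ≤ q) (hu0 : 0 < u) (hu : u ^ 2 < q) {c : ℕ → ℕ} (hc : Antitone c)
    (heven : ∀ i, Even i → Even (c i - c (i + 1))) (n : ℕ) :
    prefixProb q u c n = normConst q u * (∏ i ∈ Finset.range (n + 1), colMass q u (c i)) /
      (∏ i ∈ Finset.range n, (evenPoch q ((c i - c (i + 1)) / 2) *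
        (q : ℝ) ^ (if Even i then 0 else c (i + 1)))) *
      ((if Even n then u ^ (c n % 2) else 1) / altProd q u (c n)) := by
  have h0 : (q : ℝ) ≠ 0 := by positivity
  induction n with
  | zero => simp [prefixProb, initProb_eq]; ring
  | succ n ih =>
    have hle : c (n + 1) ≤ c n := hc n.le_succ
    have h1 := (altProd_pos hq hu (c n)).ne'
    have h2 := (altProd_pos hq hu (c (n + 1))).ne'
    have h3 := (evenPoch_pos hq ((c n - c (n + 1)) / 2)).ne'
    rw [prefixProb_succ, ih, Finset.prod_range_succ _ (n + 1),
      Finset.prod_range_succ (fun i => evenPoch q ((c i - c (i + 1)) / 2) *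
        (q : ℝ) ^ (if Even i then 0 else c (i + 1))) n]
    generalize ∏ i ∈ Finset.range (n + 1), colMass q u (c i) = Z
    generalize ∏ i ∈ Finset.range n, (evenPoch q ((c i - c (i + 1)) / 2) *
        (q : ℝ) ^ (if Even i then 0 else c (i + 1))) = Z'
    by_cases hn : Even n
    · have hn1 : ¬ Even (n + 1) := by simpa [Nat.even_add_one] using hn
      obtain ⟨d, hd⟩ := heven n hn
      have hK : K1 q u (c n) (c (n + 1)) = colMass q u (c (n + 1)) * altProd q u (c n) /
          (altProd q u (c (n + 1)) * evenPoch q ((c n - c (n + 1)) / 2) * u ^ (c n % 2)) := by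
        have e : c n = c (n + 1) + 2 * d := by omega
        have hm : c n % 2 = c (n + 1) % 2 := by omega
        rw [hm, show (c n - c (n + 1)) / 2 = d by omega, e, K1_eq hq hu0 hu]
      simp only [stepProb, if_pos hn.add_one, if_pos hn, if_neg hn1, hK]
      field_simp
    · have hn1 : Even (n + 1) := Nat.even_add_one.2 hn
      simp only [stepProb, if_neg (Nat.not_odd_iff_even.2 hn1), if_neg hn, if_pos hn1,
        K2_eq hq hu0 hu hle]
      field_simp

lemma sum_Icc_one (f : ℕ → ℕ) (n : ℕ) :
    ∑ i ∈ Finset.Icc 1 n, f i = ∑ i ∈ Finset.range n, f (i + 1) := by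
  induction n with
  | zero => simp
  | succ n ih => rw [Finset.sum_Icc_succ_top (by omega), ih, Finset.sum_range_succ]

lemma prod_Icc_one (f : ℕ → ℝ) (n : ℕ) :
    ∏ i ∈ Finset.Icc 1 n, f i = ∏ i ∈ Finset.range n, f (i + 1) := by
  induction n with
  | zero => simp
  | succ n ih => rw [Finset.prod_Icc_succ_top (by omega), ih, Finset.prod_range_succ]

/-- The columns of `l` occur with the probability that `R_(u,q)` gives to `l`. -/
lemma prefixProb_col (hq : 2 ≤ q) (hu0 : 0 < u) (hu : u ^ 2 < q) (l : Ptn) :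
    prefixProb q u (fun i => l.col (i + 1)) l.size = weight q u l := by
  have h0 : (0 : ℝ) < q := by positivity
  have hz : l.col (l.size + 1) = 0 := l.col_eq_zero (by omega)
  -- `(|λ| + o(λ)) / 2` is the sum of the columns in odd positions, the first of which is `l(λ)`
  have hexp : (l.nStat : ℝ) + (l.size : ℝ) / 2 + (l.numOdd : ℝ) / 2 =
      ((l.nStat + (l.length +
        ∑ i ∈ Finset.range l.size, if Even i then 0 else l.col (i + 2)) : ℕ) : ℝ) := by
    have h := l.two_mul_sum_odd_col (N := l.size + 1) (by omega)
    rw [Finset.sum_range_succ'] at h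
    have e : ∀ i, (if Even (i + 1) then l.col (i + 1 + 1) else 0) =
        if Even i then 0 else l.col (i + 2) := by
      intro i
      simp only [Nat.even_add_one]
      split_ifs <;> simp_all
    simp only [e, Even.zero, if_true, zero_add, Ptn.col_one] at h
    have h' : (2 : ℝ) * ((∑ i ∈ Finset.range l.size, if Even i then 0 else l.col (i + 2) : ℕ) +
      l.length) = l.size + l.numOdd := by exact_mod_cast h
    push_cast at h' ⊢
    linarith
  rw [prefixProb_eq hq hu0 hu (fun i j h => l.antitone_col (by omega))
    (fun i hi => l.even_col_sub hi.add_one), hz, weight, hexp, Real.rpow_natCast]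
  have hD : altProd q u 0 = 1 := by simp [altProd]
  have hM0 : colMass q u 0 = 1 := by simp [colMass]
  have hM : ∏ i ∈ Finset.range l.size, colMass q u (l.col (i + 1)) =
      u ^ l.size / (q : ℝ) ^ l.nStat := by
    simp only [colMass, Finset.prod_div_distrib, Finset.prod_pow_eq_pow_sum, l.sum_col le_rfl]
    rw [Ptn.nStat, sum_Icc_one]
  have hE : ∏ i ∈ Finset.Icc 1 l.size, ∏ j ∈ Finset.Icc 1 (l.mult i / 2),
      (1 - 1 / (q : ℝ) ^ (2 * j)) = ∏ i ∈ Finset.range l.size,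
        evenPoch q ((l.col (i + 1) - l.col (i + 1 + 1)) / 2) := by
    simp only [prod_Icc_one _ l.size, ← evenPoch_eq_prod, Ptn.mult_eq]
  rw [hE, Finset.prod_mul_distrib, Finset.prod_pow_eq_pow_sum, Finset.prod_range_succ, hz, hM, hM0,
    hD]
  have hne : ∏ i ∈ Finset.range l.size,
      evenPoch q ((l.col (i + 1) - l.col (i + 1 + 1)) / 2) ≠ 0 :=
    Finset.prod_ne_zero_iff.2 fun i _ => (evenPoch_pos hq _).ne'
  simp only [Nat.zero_mod, pow_zero, ite_self, pow_add]
  field_simp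

/-! ### Bounds on the transition probabilities -/

lemma stepProb_nonneg (hq : 2 ≤ q) (hu0 : 0 < u) (hu : u ^ 2 < q) (i a b : ℕ) :
    0 ≤ stepProb q u i a b := by
  unfold stepProb
  split_ifs
  exacts [K1_nonneg hq hu0 hu a b, K2_nonneg hq hu0 hu a b]

lemma hasSum_stepProb (hq : 2 ≤ q) (hu0 : 0 < u) (hu : u ^ 2 < q) (i a : ℕ) :
    HasSum (stepProb q u i a) 1 := by
  unfold stepProb
  split_ifs
  exacts [hasSum_K1 hq hu0 hu a, hasSum_K2 hq hu0 hu a]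

lemma stepProb_le_one (hq : 2 ≤ q) (hu0 : 0 < u) (hu : u ^ 2 < q) (i a b : ℕ) :
    stepProb q u i a b ≤ 1 :=
  le_hasSum (hasSum_stepProb hq hu0 hu i a) b fun _ _ => stepProb_nonneg hq hu0 hu i a _

/-- A nonzero column length `a` can drop to `a - 1` under `K₂`. -/
lemma K2_self_lt_one (hq : 2 ≤ q) (hu0 : 0 < u) (hu : u ^ 2 < q) {a : ℕ} (ha : a ≠ 0) :
    K2 q u a a < 1 := by
  have h := sum_le_hasSum {a, a - 1} (fun b _ => K2_nonneg hq hu0 hu a b) (hasSum_K2 hq hu0 hu a)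
  rw [Finset.sum_pair (by omega)] at h
  have := K2_pos hq hu0 hu (Nat.sub_le a 1)
  linarith

/-- A transition of positive probability does not increase the column length; after an odd
position it changes it by an even amount. -/
lemma le_and_even_of_stepProb_pos {i a b : ℕ} (h : 0 < stepProb q u (i + 1) a b) :
    b ≤ a ∧ (Even i → Even (a - b)) := by
  unfold stepProb at h
  split_ifs at h with hi
  · by_contra hn
    rw [K1_eq_zero (by tauto)] at h
    exact h.false
  · refine ⟨?_, fun he => absurd he.add_one hi⟩
    by_contra hn
    rw [K2_eq_zero (by omega)] at h
    exact h.false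

/-! ### Existence of the column chain -/

/-- The measure on `ℕ` with point masses `f`. -/
noncomputable def massMeasure (f : ℕ → ℝ) : Measure ℕ :=
  Measure.sum fun b => ENNReal.ofReal (f b) • Measure.dirac b

lemma massMeasure_singleton (f : ℕ → ℝ) (b : ℕ) :
    massMeasure f {b} = ENNReal.ofReal (f b) := by
  rw [massMeasure, Measure.sum_apply _ (measurableSet_singleton b), tsum_eq_single b]
  · simp
  · intro c hc
    simp [hc]

lemma isProbabilityMeasure_massMeasure {f : ℕ → ℝ} (h0 : ∀ b, 0 ≤ f b) (h1 : HasSum f 1) :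
    IsProbabilityMeasure (massMeasure f) := by
  refine ⟨?_⟩
  rw [massMeasure, Measure.sum_apply _ MeasurableSet.univ]
  simp only [Measure.smul_apply, measure_univ, smul_eq_mul, mul_one]
  rw [← ENNReal.ofReal_tsum_of_nonneg h0 h1.summable, h1.tsum_eq, ENNReal.ofReal_one]

/-- The transition from the first `n + 1` columns to the next one, as a Markov kernel. -/
noncomputable def stepKernel (q : ℕ) (u : ℝ) (n : ℕ) : Kernel (Finset.Iic n → ℕ) ℕ :=
  (Kernel.ofFunOfCountable fun a : ℕ => massMeasure (stepProb q u (n + 1) a)).comap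
    (fun x => x ⟨n, Finset.mem_Iic.2 le_rfl⟩) (measurable_pi_apply _)

lemma exists_isColumnChain (hq : 2 ≤ q) (hu0 : 0 < u) (hu : u ^ 2 < q) :
    ∃ μ : Measure (ℕ → ℕ), IsProbabilityMeasure μ ∧ IsColumnChain q u μ (fun i ω => ω i) := by
  have hk (n : ℕ) : IsMarkovKernel (stepKernel q u n) := by
    have : IsMarkovKernel
        (Kernel.ofFunOfCountable fun a : ℕ => massMeasure (stepProb q u (n + 1) a)) :=
      ⟨fun a => isProbabilityMeasure_massMeasure (stepProb_nonneg hq hu0 hu (n + 1) a)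
        (hasSum_stepProb hq hu0 hu (n + 1) a)⟩
    unfold stepKernel
    infer_instance
  have hi := isProbabilityMeasure_massMeasure (initProb_nonneg hq hu0 hu) (hasSum_initProb hq hu0 hu)
  let μ : Measure (ℕ → ℕ) := Kernel.trajMeasure (X := fun _ => ℕ) (massMeasure (initProb q u))
    (stepKernel q u)
  have hμ : IsProbabilityMeasure μ := by infer_instance
  refine ⟨μ, hμ, ⟨fun i => measurable_pi_apply i, fun a => ?_, fun n a b => ?_⟩⟩
  · have h0 : μ.map (Preorder.frestrictLe 0) = (massMeasure (initProb q u)).map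
        (MeasurableEquiv.piUnique fun _ : Finset.Iic 0 => ℕ).symm := by
      simp only [μ, Kernel.trajMeasure]
      rw [Measure.map_comp _ _ (by fun_prop), Kernel.traj_map_frestrictLe, Kernel.partialTraj_self,
        Measure.id_comp]
    have hs : MeasurableSet {x : Finset.Iic 0 → ℕ | x ⟨0, Finset.mem_Iic.2 le_rfl⟩ = a} :=
      (measurable_pi_apply (X := fun _ : Finset.Iic 0 => ℕ) _) (measurableSet_singleton a)
    have h1 := congrArg (fun ν => ν {x | x ⟨0, Finset.mem_Iic.2 le_rfl⟩ = a}) h0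
    rw [Measure.map_apply (by fun_prop) hs, Measure.map_apply (by fun_prop) hs] at h1
    rw [← massMeasure_singleton]
    exact h1
  · have h := Kernel.map_frestrictLe_trajMeasure_compProd_eq_map_trajMeasure (X := fun _ => ℕ)
      (μ₀ := massMeasure (initProb q u)) (κ := stepKernel q u) (a := n)
    let s : Set (Finset.Iic n → ℕ) := {fun i : Finset.Iic n => a i}
    have hs : MeasurableSet s := measurableSet_singleton _
    have hpre : {ω : ℕ → ℕ | ∀ i ≤ n, ω i = a i} = Preorder.frestrictLe n ⁻¹' s := by
      ext ω
      simp [s, funext_iff]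
    have h2 := congrArg (fun ν => ν (s ×ˢ {b})) h
    beta_reduce at h2
    rw [Measure.compProd_apply_prod hs (measurableSet_singleton b),
      Measure.map_apply (by fun_prop) (hs.prod (measurableSet_singleton b)),
      lintegral_singleton, Measure.map_apply (by fun_prop) hs] at h2
    have hK : stepKernel q u n (fun i => a i) {b} =
        ENNReal.ofReal (stepProb q u (n + 1) (a n) b) := massMeasure_singleton _ b
    rw [hK, ← hpre, mul_comm] at h2
    refine Eq.trans ?_ h2.symm
    congr 1
    ext ω
    simp [s, funext_iff]

/-! ### The law of the partition generated by a column chain -/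

section Chain

variable {Ω : Type*} [MeasurableSpace Ω] {μ : Measure Ω} {X : ℕ → Ω → ℕ}

lemma prefixProb_nonneg (hq : 2 ≤ q) (hu0 : 0 < u) (hu : u ^ 2 < q) (c : ℕ → ℕ) (n : ℕ) :
    0 ≤ prefixProb q u c n :=
  mul_nonneg (initProb_nonneg hq hu0 hu _)
    (Finset.prod_nonneg fun _ _ => stepProb_nonneg hq hu0 hu _ _ _)

lemma IsColumnChain.measure_prefix (hX : IsColumnChain q u μ X) (hq : 2 ≤ q) (hu0 : 0 < u)
    (hu : u ^ 2 < q) (c : ℕ → ℕ) (n : ℕ) :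
    μ {ω | ∀ i ≤ n, X i ω = c i} = ENNReal.ofReal (prefixProb q u c n) := by
  induction n with
  | zero => simpa [prefixProb] using hX.init (c 0)
  | succ n ih =>
    have e : {ω | ∀ i ≤ n + 1, X i ω = c i} =
        {ω | (∀ i ≤ n, X i ω = c i) ∧ X (n + 1) ω = c (n + 1)} := by
      ext ω
      simp only [Set.mem_ofPred_eq, Nat.le_succ_iff_eq_or_le, Nat.succ_eq_add_one]
      grind
    rw [e, hX.step, ih, prefixProb_succ, ENNReal.ofReal_mul (prefixProb_nonneg hq hu0 hu c n)]

lemma IsColumnChain.ae_stepProb_pos (hX : IsColumnChain q u μ X) (hq : 2 ≤ q) (hu0 : 0 < u)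
    (hu : u ^ 2 < q) :
    ∀ᵐ ω ∂μ, ∀ n, 0 < stepProb q u (n + 1) (X n ω) (X (n + 1) ω) := by
  refine ae_all_iff.2 fun n => ?_
  -- every history of length `n + 1` is encoded by a list, and there are countably many lists
  have h (p : List ℕ × ℕ) : ∀ᵐ ω ∂μ, stepProb q u (n + 1) (p.1.getD n 0) p.2 = 0 →
      ¬ ((∀ i ≤ n, X i ω = p.1.getD i 0) ∧ X (n + 1) ω = p.2) := by
    by_cases h0 : stepProb q u (n + 1) (p.1.getD n 0) p.2 = 0
    · have := hX.step n (fun i => p.1.getD i 0) p.2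
      rw [h0, ENNReal.ofReal_zero, mul_zero] at this
      filter_upwards [measure_eq_zero_iff_ae_notMem.1 this] with ω hω _ using hω
    · exact .of_forall fun _ h => absurd h h0
  filter_upwards [ae_all_iff.2 h] with ω hω
  refine (stepProb_nonneg hq hu0 hu _ _ _).lt_of_ne' fun h0 => ?_
  have e : ∀ i ≤ n, X i ω = ((List.range (n + 1)).map fun i => X i ω).getD i 0 := by
    intro i hi
    simp [List.getD_eq_getElem?_getD, Nat.lt_succ_of_le hi]
  exact hω (((List.range (n + 1)).map fun i => X i ω), X (n + 1) ω)
    (by rw [← e n le_rfl]; exact h0) ⟨e, rfl⟩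

lemma IsColumnChain.ae_antitone (hX : IsColumnChain q u μ X) (hq : 2 ≤ q) (hu0 : 0 < u)
    (hu : u ^ 2 < q) : ∀ᵐ ω ∂μ, Antitone fun i => X i ω := by
  filter_upwards [hX.ae_stepProb_pos hq hu0 hu] with ω hω
  exact antitone_nat_of_succ_le fun n => (le_and_even_of_stepProb_pos (hω n)).1

/-- Almost surely the chain is not eventually constant at a positive value: every second step
stays at `a ≠ 0` with the fixed probability `K₂(a,a) < 1` only. -/
lemma IsColumnChain.ae_not_eventually_const (hX : IsColumnChain q u μ X) (hq : 2 ≤ q)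
    (hu0 : 0 < u) (hu : u ^ 2 < q) :
    ∀ᵐ ω ∂μ, ∀ (L : List ℕ) (a : ℕ), a ≠ 0 → ¬ ∀ i, X i ω = L.getD i a := by
  refine ae_all_iff.2 fun L => ae_all_iff.2 fun a => ?_
  by_cases ha : a = 0
  · simp [ha]
  have hr := K2_self_lt_one hq hu0 hu ha
  have hr0 := K2_nonneg hq hu0 hu a a
  set c : ℕ → ℕ := fun i => L.getD i a with hc
  have hca {i : ℕ} (hi : L.length ≤ i) : c i = a := List.getD_eq_default _ _ hi
  have hbound (k : ℕ) : prefixProb q u c (L.length + 2 * k) ≤ K2 q u a a ^ k := by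
    induction k with
    | zero =>
      refine mul_le_one₀ (le_hasSum (hasSum_initProb hq hu0 hu) _
        fun _ _ => initProb_nonneg hq hu0 hu _) ?_ ?_
      · exact Finset.prod_nonneg fun _ _ => stepProb_nonneg hq hu0 hu _ _ _
      · exact Finset.prod_le_one (fun _ _ => stepProb_nonneg hq hu0 hu _ _ _)
          fun _ _ => stepProb_le_one hq hu0 hu _ _ _
    | succ k ih =>
      have two : stepProb q u (L.length + 2 * k + 1) a a *
          stepProb q u (L.length + 2 * k + 1 + 1) a a ≤ K2 q u a a := by
        have h1 := stepProb_le_one hq hu0 hu 1 a a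
        rw [stepProb, if_pos odd_one] at h1
        rcases Nat.even_or_odd (L.length + 2 * k + 1) with h | h
        · rw [stepProb, stepProb, if_neg (by simpa using h), if_pos h.add_one]
          exact mul_le_of_le_one_right hr0 h1
        · rw [stepProb, stepProb, if_pos h, if_neg (by simpa using h.add_one)]
          exact mul_le_of_le_one_left hr0 h1
      rw [show L.length + 2 * (k + 1) = L.length + 2 * k + 1 + 1 by ring, prefixProb_succ,
        prefixProb_succ, hca (by omega), hca (by omega), hca (by omega), mul_assoc, pow_succ]
      exact mul_le_mul ih two (mul_nonneg (stepProb_nonneg hq hu0 hu _ _ _)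
        (stepProb_nonneg hq hu0 hu _ _ _)) (pow_nonneg hr0 k)
  have hle (k : ℕ) : μ {ω | ∀ i, X i ω = c i} ≤ ENNReal.ofReal (K2 q u a a ^ k) := by
    refine (measure_mono (Set.ofPred_subset_ofPred.2 fun ω hω i _ => hω i)).trans
      ((hX.measure_prefix hq hu0 hu c (L.length + 2 * k)).le.trans ?_)
    exact ENNReal.ofReal_le_ofReal (hbound k)
  have hlim : Filter.Tendsto (fun k => ENNReal.ofReal (K2 q u a a ^ k)) Filter.atTop (nhds 0) := by
    simpa using ENNReal.tendsto_ofReal (tendsto_pow_atTop_nhds_zero_of_lt_one hr0 hr)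
  have hz : μ {ω | ∀ i, X i ω = c i} = 0 := le_antisymm (ge_of_tendsto' hlim hle) zero_le
  filter_upwards [measure_eq_zero_iff_ae_notMem.1 hz] with ω hω _ using hω

/-- Almost surely the chain is the sequence of column lengths of a partition. -/
lemma IsColumnChain.ae_exists_col (hX : IsColumnChain q u μ X) (hq : 2 ≤ q) (hu0 : 0 < u)
    (hu : u ^ 2 < q) : ∀ᵐ ω ∂μ, ∃ l : Ptn, ∀ i, X i ω = l.col (i + 1) := by
  filter_upwards [hX.ae_stepProb_pos hq hu0 hu, hX.ae_antitone hq hu0 hu,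
    hX.ae_not_eventually_const hq hu0 hu] with ω hpos hanti hconst
  let n := Function.argmin (fun i => X i ω)
  have hn (m : ℕ) (hm : n ≤ m) : X m ω = X n ω :=
    le_antisymm (hanti hm) (Function.argmin_le (fun i => X i ω) m)
  refine Ptn.exists_col_eq hanti (fun i => (le_and_even_of_stepProb_pos (hpos i)).2) (N := n) ?_
  by_contra h0
  refine hconst ((List.range n).map fun i => X i ω) (X n ω) h0 fun i => ?_
  rcases lt_or_ge i n with h | h
  · simp [List.getD_eq_getElem?_getD, h]
  · rw [List.getD_eq_default _ _ (by simpa using h), hn i h]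

/-- The chain follows the columns of `l` with the probability that `R_(u,q)` gives to `l`. -/
lemma IsColumnChain.measure_col (hX : IsColumnChain q u μ X) (hq : 2 ≤ q) (hu0 : 0 < u)
    (hu : u ^ 2 < q) (l : Ptn) :
    μ {ω | ∀ i, X i ω = l.col (i + 1)} = ENNReal.ofReal (weight q u l) := by
  rw [← prefixProb_col hq hu0 hu, ← hX.measure_prefix hq hu0 hu]
  refine measure_congr ?_
  filter_upwards [hX.ae_antitone hq hu0 hu] with ω hω
  refine propext ⟨fun h i _ => h i, fun h i => ?_⟩
  rcases le_total i l.size with hi | hi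
  · exact h i hi
  · -- beyond `|λ|` both sides vanish
    have h1 : X i ω ≤ X l.size ω := hω hi
    have h2 : X l.size ω = l.col (l.size + 1) := h l.size le_rfl
    rw [l.col_eq_zero (by omega)] at h2
    rw [l.col_eq_zero (by omega)]
    omega

end Chain

instance : Countable Ptn :=
  inferInstanceAs (Countable {p : Σ n : ℕ, n.Partition //
    ∀ i : ℕ, Odd i → Even (p.2.parts.count i)})

instance : DiscreteMeasurableSpace Ptn := ⟨fun _ => trivial⟩

lemma R_singleton (q : ℕ) (u : ℝ) (l : Ptn) : R q u {l} = ENNReal.ofReal (weight q u l) := by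
  rw [R, Measure.sum_apply _ (measurableSet_singleton l), tsum_eq_single l]
  · simp
  · intro c hc
    simp [hc]

/-- The sequence of column lengths of a partition. -/
def Ptn.colSeq (l : Ptn) (i : ℕ) : ℕ := l.col (i + 1)

lemma Ptn.colSeq_injective : Function.Injective Ptn.colSeq :=
  fun _ _ h => Ptn.ext_col fun i => congrFun h i

lemma Ptn.measurableEmbedding_colSeq : MeasurableEmbedding Ptn.colSeq where
  injective := Ptn.colSeq_injective
  measurable := .of_discrete
  measurableSet_image' s _ := (s.to_countable.image _).measurableSet

lemma IsColumnChain.exists_hasLaw {Ω : Type*} [MeasurableSpace Ω] {μ : Measure Ω}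
    {X : ℕ → Ω → ℕ} (hX : IsColumnChain q u μ X) (hq : 2 ≤ q) (hu0 : 0 < u) (hu : u ^ 2 < q) :
    ∃ Λ : Ω → Ptn, Measurable Λ ∧ (∀ᵐ ω ∂μ, ∀ i : ℕ, X i ω = (Λ ω).col (i + 1)) ∧
      HasLaw Λ (R q u) μ := by
  obtain ⟨l₀, -⟩ : ∃ l : Ptn, ∀ i, (fun _ => 0 : ℕ → ℕ) i = l.col (i + 1) :=
    Ptn.exists_col_eq (N := 0) (fun _ _ _ => le_rfl) (by simp) rfl
  -- the inverse of `colSeq`, with the value `l₀` off its range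
  let Λ : Ω → Ptn := fun ω => Function.extend Ptn.colSeq id (fun _ => l₀) fun i => X i ω
  have hΛ {ω : Ω} {l : Ptn} (h : ∀ i, X i ω = l.col (i + 1)) : Λ ω = l := by
    have e : (fun i => X i ω) = l.colSeq := funext h
    simp only [Λ, e, Ptn.colSeq_injective.extend_apply, id]
  have hm : Measurable Λ :=
    (Ptn.measurableEmbedding_colSeq.measurable_extend measurable_id measurable_const).comp
      (measurable_pi_lambda _ hX.measurable)
  have hcol : ∀ᵐ ω ∂μ, ∀ i : ℕ, X i ω = (Λ ω).col (i + 1) := by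
    filter_upwards [hX.ae_exists_col hq hu0 hu] with ω ⟨l, hl⟩
    rwa [hΛ hl]
  refine ⟨Λ, hm, hcol, hm.aemeasurable, Measure.ext_of_singleton fun l => ?_⟩
  rw [Measure.map_apply hm (measurableSet_singleton l), R_singleton, ← hX.measure_col hq hu0 hu]
  refine measure_congr ?_
  filter_upwards [hcol] with ω hω
  refine propext ⟨fun h => ?_, fun h => hΛ h⟩
  obtain rfl : Λ ω = l := h
  exact hω

end RandomPartition

theorem theorem6p3 (q : ℕ) (hq : IsPrimePow q) (u : ℝ) (hu : 0 < u) (huq : u < Real.sqrt q) :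
    -- the prescribed initial law and the two kernels are probability distributions
    ((∀ a, 0 ≤ RandomPartition.initProb q u a) ∧ HasSum (RandomPartition.initProb q u) 1) ∧
    (∀ a, (∀ b, 0 ≤ RandomPartition.K1 q u a b) ∧ HasSum (RandomPartition.K1 q u a) 1) ∧
    (∀ a, (∀ b, 0 ≤ RandomPartition.K2 q u a b) ∧ HasSum (RandomPartition.K2 q u a) 1) ∧
    -- the sampling procedure can be carried out
    (∃ μ : Measure (ℕ → ℕ), IsProbabilityMeasure μ ∧
      RandomPartition.IsColumnChain q u μ (fun i ω => ω i)) ∧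
    -- however it is carried out, the resulting sequence is almost surely the sequence of column
    -- lengths of a partition `Λ`, and `Λ` is distributed according to `R_(u,q)`
    (∀ (Ω : Type*) [MeasurableSpace Ω] (μ : Measure Ω) [IsProbabilityMeasure μ] (X : ℕ → Ω → ℕ),
      RandomPartition.IsColumnChain q u μ X →
      ∃ Λ : Ω → RandomPartition.Ptn, Measurable Λ ∧
        (∀ᵐ ω ∂μ, ∀ i : ℕ, X i ω = (Λ ω).col (i + 1)) ∧
        HasLaw Λ (RandomPartition.R q u) μ) := by
  have hq2 : 2 ≤ q := hq.two_le
  have hu2 : u ^ 2 < q := (Real.lt_sqrt hu.le).1 huq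
  exact ⟨⟨RandomPartition.initProb_nonneg hq2 hu hu2, RandomPartition.hasSum_initProb hq2 hu hu2⟩,
    fun a => ⟨RandomPartition.K1_nonneg hq2 hu hu2 a, RandomPartition.hasSum_K1 hq2 hu hu2 a⟩,
    fun a => ⟨RandomPartition.K2_nonneg hq2 hu hu2 a, RandomPartition.hasSum_K2 hq2 hu hu2 a⟩,
    RandomPartition.exists_isColumnChain hq2 hu hu2,
    fun _ _ _ _ _ hX => hX.exists_hasLaw hq2 hu hu2⟩
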